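/- Let $\mathbb{N}=\{1,2,\dots\}$. For $r,d\in\mathbb{N}$ let $$\mathcal C^r_d=\{f\in C^r([0,1]^d):\ \|D^\beta f\|_\infty\le 1\ \text{ for all }\beta\in\mathbb{N}_0^d\text{ with }|\beta|_1\le r\},$$ where $\|g\|_\infty=\sup_{x\in[0,1]^d}|g(x)|$, and let $S_d(f)=\int_{[0,1]^d}f(x)\,dx$. For $n\in\mathbb{N}$ an algorithm using $n$ function values is a map $A_n(f)=\phi_n(f(x_1),\dots,f(x_n))$ with an arbitrary map $\phi_n:\mathbb{R}^n\to\mathbb{R}$ and sample points $x_i\in[0,1]^d$ that may be chosen adaptively, i.e. $x_i$ may depend on $f(x_1),\dots,f(x_{i-1})$. Let $$e_n(\mathcal C^r_d)=\inf_{A_n}\ \sup_{f\in\mathcal C^r_d}|S_d(f)-A_n(f)|$$ be the $n$th minimal worst-case error, the infimum being over all such algorithms. Theorem. For every $r\in\mathbb{N}$ there exist constants $c_{r,1},c_{r,2}>0$, depending only on $r$, such that for all $d,n\in\mathbb{N}$ with $n=m^d$ for some $m\in\mathbb{N}$, $$\min\bigl\{\tfrac12,\ c_{r,1}\,d\,n^{-r/d}\bigr\}\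 \le\ e_n(\mathcal C^r_d)\ \le\ \min\bigl\{1,\ c_{r,2}\,d\,n^{-r/d}\bigr\}.$$ With the same constants, the lower bound holds for all $d,n\in\mathbb{N}$, and for all $d,n\in\mathbb{N}$ one has the upper bound $$e_n(\mathcal C^r_d)\ \le\ \min\bigl\{1,\ c_{r,2}\,d\,(n^{1/d}-1)^{-r}\bigr\},$$ where for $n=1$ we read $0^{-r}=\infty$, so that the bound is then $1$. -/

import Mathlib

open MeasureTheory Set
open scoped ENNReal

/-- The closed unit cube `[0,1]^d`. -/
def unitCube (d : ℕ) : Set (Fin d → ℝ) := Icc 0 1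

/-- The mixed partial derivative `∂_{w 0} ⋯ ∂_{w (k-1)} f (x)` of order `k` on the closed unit cube
(one-sided at the boundary). For `f` of class `C^k` this is `D^β f (x)` with the multi-index
`β j = #{i | w i = j}`, and every `β` with `|β|_1 = k` arises from such a word `w`. -/
noncomputable def mixedPartial {d k : ℕ} (w : Fin k → Fin d) (f : (Fin d → ℝ) → ℝ)
    (x : Fin d → ℝ) : ℝ :=
  iteratedFDerivWithin ℝ k f (unitCube d) x (fun i => Pi.single (w i) (1 : ℝ))

/-- The class of `r` times continuously differentiable functions on `[0,1]^d` all of whose partial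
derivatives of order at most `r` (the function itself included) are bounded by one. A function on
the cube is represented by any extension to `ℝ^d`; only the values on the cube matter. -/
def smoothClass (r d : ℕ) : Set ((Fin d → ℝ) → ℝ) :=
  {f | ContDiffOn ℝ r f (unitCube d) ∧
    ∀ k : ℕ, k ≤ r → ∀ w : Fin k → Fin d, ∀ x ∈ unitCube d, |mixedPartial w f x| ≤ 1}

/-- The integral `S_d(f) = ∫_{[0,1]^d} f(x) dx`. -/
noncomputable def cubeIntegral (d : ℕ) (f : (Fin d → ℝ) → ℝ) : ℝ :=
  ∫ x in unitCube d, f x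

/-- A deterministic algorithm using `n` function values. The sample points may be chosen adaptively:
`point k y` is the next sample point after the values `y 0, …, y (k-1)` have been computed
(only `k < n` is used). The output is an arbitrary function of the `n` values. -/
structure SamplingAlgorithm (d n : ℕ) where
  point : (k : ℕ) → (Fin k → ℝ) → unitCube d
  output : (Fin n → ℝ) → ℝ

/-- The first `k` function values computed by the algorithm on the input `f`. -/
def SamplingAlgorithm.info {d n : ℕ} (A : SamplingAlgorithm d n) (f : (Fin d → ℝ) → ℝ) :
    (k : ℕ) → Fin k → ℝ
  | 0 => Fin.elim0
  | k + 1 => Fin.snoc (α := fun _ => ℝ) (A.info f k)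
      (f (A.point k (A.info f k) : Fin d → ℝ))

/-- The result `A_n(f)` of the algorithm on the input `f`. -/
def SamplingAlgorithm.run {d n : ℕ} (A : SamplingAlgorithm d n) (f : (Fin d → ℝ) → ℝ) : ℝ :=
  A.output (A.info f n)

/-- The worst case error `sup_f |S_d(f) - A_n(f)|` over the class, possibly infinite. -/
noncomputable def SamplingAlgorithm.worstCaseError {d n : ℕ} (A : SamplingAlgorithm d n)
    (r : ℕ) : ℝ≥0∞ :=
  ⨆ f ∈ smoothClass r d, ENNReal.ofReal |cubeIntegral d f - A.run f|

/-- The `n`-th minimal worst case error of integration over the class. -/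
noncomputable def minimalError (r d n : ℕ) : ℝ≥0∞ :=
  ⨅ A : SamplingAlgorithm d n, A.worstCaseError r

/-! Upper bound. On `[0,1]` there is a quadrature rule with nonnegative weights of sum one that is
exact for degrees below `r`; its number `N` of nodes depends only on `r`. Copied to `M` cells of
length `1/M`, it has error at most `2 M^{-r}` along each axis (`composite_rule_error_le`). For a
tensor product of such rules the one-dimensional errors only add up, because averaging with positive
weights of sum one does not enlarge errors (`product_rule_error_le`). This gives `2 d M^{-r}` with
`(M N)^d` nodes, and `M` of order `n^{1/d} / N`.

Lower bound. Given `n` points, take a truncated multiple of the `ℓ¹` distance to them and convolve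
it with a product kernel supported in `[-δ,δ]^d`, with `δ` proportional to `n^{-1/d}`. The `ℓ¹` norm
makes the factor `d` appear: a step along one axis changes the distance by at most the length of the
step, yet balls of radius `3dδ` still have volume at most `(6eδ)^d`, so `n` of them fill at most
half of the cube. In a derivative of the convolution one differentiation is charged to the Lipschitz
constant `L` and the others to the kernel, whose undifferentiated factors have integral one; hence
the bounds do not depend on `d`, and `L` of order `δ^{r-1}` is admissible. The result vanishes at
the points and has integral at least of order `min(1, d δ^r)` (`exists_fooling_function`). Applied
to the points chosen for zero data, it defeats adaptive algorithms too, since `f` and `-f` produce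
the same data as `0`. -/

/-! ### Positive quadrature on the unit interval. -/

/-- In finite dimension the convex hull of a compact set is compact. -/
theorem IsCompact.convexHull_of_finiteDimensional {E : Type*} [NormedAddCommGroup E]
    [NormedSpace ℝ E] [FiniteDimensional ℝ E] {K : Set E} (hK : IsCompact K) :
    IsCompact (convexHull ℝ K) := by
  rcases K.eq_empty_or_nonempty with rfl | ⟨z₀, hz₀⟩
  · simp
  -- By Carathéodory this many points always suffice, so the hull is the continuous image of the
  -- compact set simplex × `K^n`. Shorter combinations are padded with weight zero at `z₀`.
  let n := Module.finrank ℝ E + 1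
  let F : (Fin n → ℝ) × (Fin n → E) → E := fun p => ∑ i, p.1 i • p.2 i
  have hF : Continuous F := by fun_prop
  have himg : F '' (stdSimplex ℝ (Fin n) ×ˢ univ.pi fun _ => K) = convexHull ℝ K := by
    apply Subset.antisymm
    · rintro _ ⟨⟨w, z⟩, ⟨hw, hz⟩, rfl⟩
      exact (convex_convexHull ℝ K).sum_mem (fun i _ => hw.1 i) hw.2
        fun i _ => subset_convexHull ℝ K (hz i trivial)
    · intro x hx
      obtain ⟨ι, _, z, w, hzK, hind, hw, hw1, hx⟩ := eq_pos_convex_span_of_mem_convexHull hx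
      have hcard : Fintype.card ι ≤ Fintype.card (Fin n) := by
        rw [Fintype.card_fin]
        exact hind.card_le_finrank_succ.trans (Nat.succ_le_succ (Submodule.finrank_le _))
      obtain ⟨e⟩ := Function.Embedding.nonempty_of_card_le hcard
      have hnot : ∀ j, j ∉ range e → Function.extend e w 0 j = 0 := fun j hj =>
        Function.extend_apply' _ _ _ hj
      refine ⟨(Function.extend e w 0, Function.extend e z fun _ => z₀), ⟨⟨fun j => ?_, ?_⟩,
        fun j _ => ?_⟩, ?_⟩
      · by_cases hj : j ∈ range e
        · obtain ⟨i, rfl⟩ := hj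
          simpa [e.injective.extend_apply] using (hw i).le
        · simp [hnot j hj]
      · rw [← hw1]
        exact (Fintype.sum_of_injective e e.injective _ _ hnot
          fun i => (e.injective.extend_apply _ _ _).symm).symm
      · by_cases hj : j ∈ range e
        · obtain ⟨i, rfl⟩ := hj
          simpa [e.injective.extend_apply] using hzK (mem_range_self i)
        · simpa [Function.extend_apply' _ _ _ hj] using hz₀
      · rw [← hx]
        refine (Fintype.sum_of_injective e e.injective _ _ (fun j hj => ?_) fun i => ?_).symm
        · simp [hnot j hj]
        · simp [e.injective.extend_apply]
  rw [← himg]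
  exact ((isCompact_stdSimplex ℝ _).prod (isCompact_univ_pi fun _ => hK)).image hF

/-- The mean of the moment curve `x ↦ (x^k)_{k<r}` lies in the closed convex hull of the curve,
hence is a finite convex combination of points on it; the coefficients are the weights. -/
theorem exists_positive_quadrature (r : ℕ) :
    ∃ (N : ℕ) (w t : Fin N → ℝ), (∀ i, 0 ≤ w i) ∧ ∑ i, w i = 1 ∧ (∀ i, t i ∈ Icc (0 : ℝ) 1) ∧
      ∀ k < r, ∫ x in Icc (0 : ℝ) 1, x ^ k = ∑ i, w i * t i ^ k := by
  let γ : ℝ → Fin r → ℝ := fun x k => x ^ (k : ℕ)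
  have hγ : Continuous γ := by fun_prop
  have hK : IsCompact (γ '' Icc 0 1) := isCompact_Icc.image hγ
  have hprob : IsProbabilityMeasure (volume.restrict (Icc (0 : ℝ) 1)) := ⟨by simp⟩
  have hint : IntegrableOn γ (Icc 0 1) := hγ.integrableOn_Icc
  have hmem : ∫ x in Icc (0 : ℝ) 1, γ x ∈ convexHull ℝ (γ '' Icc 0 1) :=
    (convex_convexHull ℝ _).integral_mem hK.convexHull_of_finiteDimensional.isClosed
      ((ae_restrict_mem measurableSet_Icc).mono
        fun x hx => subset_convexHull ℝ _ (mem_image_of_mem _ hx)) hint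
  obtain ⟨ι, _, w, z, hw, hw1, hz, hsum⟩ := mem_convexHull_iff_exists_fintype.1 hmem
  choose t ht htz using hz
  let e := (Fintype.equivFin ι).symm
  refine ⟨Fintype.card ι, w ∘ e, t ∘ e, fun i => hw _, ?_, fun i => ht _, fun k hk => ?_⟩
  · rw [← hw1]; exact e.sum_comp w
  · have h := congrFun hsum ⟨k, hk⟩
    rw [eval_integral (fun i => hint.eval i)] at h
    rw [Finset.sum_apply] at h
    simp only [Pi.smul_apply, smul_eq_mul, ← htz] at h
    exact h.symm.trans (e.sum_comp fun i => w i * t i ^ k).symm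

/-- Integral and rule agree on the Taylor polynomial of degree `r - 1` at `0`. Both are averages, so
each turns the pointwise remainder, at most `B`, into an error of at most `B`. -/
theorem positive_quadrature_error_le {r N : ℕ} (hr : 1 ≤ r) {w t : Fin N → ℝ} (hw : ∀ i, 0 ≤ w i)
    (hw1 : ∑ i, w i = 1) (ht : ∀ i, t i ∈ Icc (0 : ℝ) 1)
    (hex : ∀ k < r, ∫ x in Icc (0 : ℝ) 1, x ^ k = ∑ i, w i * t i ^ k)
    {g : ℝ → ℝ} (hg : ContDiffOn ℝ r g (Icc 0 1)) {B : ℝ}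
    (hB : ∀ x ∈ Icc (0 : ℝ) 1, |iteratedDerivWithin r g (Icc 0 1) x| ≤ B) :
    |(∫ x in Icc (0 : ℝ) 1, g x) - ∑ i, w i * g (t i)| ≤ 2 * B := by
  obtain ⟨n, rfl⟩ : ∃ n, r = n + 1 := ⟨r - 1, by omega⟩
  have hB0 : 0 ≤ B := (abs_nonneg _).trans (hB 0 (by simp))
  let T := taylorWithinEval g n (Icc 0 1) 0
  let a : ℕ → ℝ := fun k => ((k.factorial : ℝ)⁻¹) * iteratedDerivWithin k g (Icc 0 1) 0
  have hT : ∀ x, T x = ∑ k ∈ Finset.range (n + 1), a k * x ^ k := fun x => by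
    simp only [T, a, taylor_within_apply, sub_zero, smul_eq_mul]
    exact Finset.sum_congr rfl fun k _ => by ring
  have hTc : Continuous T := by
    rw [funext hT]; fun_prop
  have hTint : ∫ x in Icc (0 : ℝ) 1, T x = ∑ i, w i * T (t i) := by
    simp only [hT]
    rw [integral_finsetSum _ fun k _ => (by fun_prop : Continuous _).integrableOn_Icc]
    simp only [Finset.mul_sum]
    rw [Finset.sum_comm]
    refine Finset.sum_congr rfl fun k hk => ?_
    rw [integral_const_mul, hex k (Finset.mem_range.1 hk), Finset.mul_sum]
    exact Finset.sum_congr rfl fun i _ => by ring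
  have hrem : ∀ x ∈ Icc (0 : ℝ) 1, |g x - T x| ≤ B := fun x hx => by
    have h := taylor_mean_remainder_bound zero_le_one (by exact_mod_cast hg) hx hB
    refine h.trans ?_
    rw [sub_zero]
    have h1 : x ^ (n + 1) ≤ 1 := pow_le_one₀ hx.1 hx.2
    have h2 : (1 : ℝ) ≤ n.factorial := by exact_mod_cast n.factorial_pos
    rw [div_le_iff₀ (by positivity)]
    exact mul_le_mul_of_nonneg_left (h1.trans h2) hB0
  have hint : (∫ x in Icc (0 : ℝ) 1, g x) - ∫ x in Icc (0 : ℝ) 1, T x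
      = ∫ x in Icc (0 : ℝ) 1, (g x - T x) :=
    (integral_sub hg.continuousOn.integrableOn_Icc hTc.integrableOn_Icc).symm
  have h1 : |∫ x in Icc (0 : ℝ) 1, (g x - T x)| ≤ B := by
    simpa using norm_setIntegral_le_of_norm_le_const (μ := volume)
      (by simp : volume (Icc (0 : ℝ) 1) < ⊤) (f := fun x => g x - T x) hrem
  have h2 : |∑ i, w i * (T (t i) - g (t i))| ≤ B := by
    calc _ ≤ ∑ i, |w i * (T (t i) - g (t i))| := Finset.abs_sum_le_sum_abs _ _
      _ ≤ ∑ i, w i * B := Finset.sum_le_sum fun i _ => by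
          rw [abs_mul, abs_of_nonneg (hw i), abs_sub_comm]
          exact mul_le_mul_of_nonneg_left (hrem _ (ht i)) (hw i)
      _ = B := by rw [← Finset.sum_mul, hw1, one_mul]
  have h3 : (∫ x in Icc (0 : ℝ) 1, g x) - ∑ i, w i * g (t i)
      = (∫ x in Icc (0 : ℝ) 1, (g x - T x)) + ∑ i, w i * (T (t i) - g (t i)) := by
    simp only [mul_sub, Finset.sum_sub_distrib]
    rw [← hint, hTint]; ring
  rw [h3]
  linarith [abs_add_le (∫ x in Icc (0 : ℝ) 1, (g x - T x)) (∑ i, w i * (T (t i) - g (t i)))]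

/-! ### Restriction to coordinate directions and composite rules. -/

theorem interior_unitCube_nonempty (d : ℕ) : (interior (unitCube d)).Nonempty := by
  refine ⟨fun _ => 1 / 2, ?_⟩
  rw [unitCube, ← pi_univ_Icc, interior_pi_set finite_univ]
  intro i _
  simp only [interior_Icc]
  constructor <;> norm_num

theorem uniqueDiffOn_unitCube (d : ℕ) : UniqueDiffOn ℝ (unitCube d) :=
  uniqueDiffOn_convex (convex_Icc 0 1) (interior_unitCube_nonempty d)

open scoped Pointwise in
/-- Restriction of a member of the class to a segment in the direction of a coordinate axis. -/
theorem smoothClass_segment {r d : ℕ} {f : (Fin d → ℝ) → ℝ} (hf : f ∈ smoothClass r d)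
    {p : Fin d → ℝ} (i : Fin d) {h : ℝ}
    (hp : ∀ t ∈ Icc (0 : ℝ) 1, p + t • Pi.single i h ∈ unitCube d) :
    ContDiffOn ℝ r (fun t : ℝ => f (p + t • Pi.single i h)) (Icc 0 1) ∧
      ∀ t ∈ Icc (0 : ℝ) 1,
        |iteratedDerivWithin r (fun t : ℝ => f (p + t • Pi.single i h)) (Icc 0 1) t| ≤ |h| ^ r := by
  -- The affine map `t ↦ p + t • v` is split into a translation and a linear map `l`, so that the
  -- chain rule for linear maps applies on `s`, the translated cube.
  let v : Fin d → ℝ := Pi.single i h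
  let F : (Fin d → ℝ) → ℝ := fun z => f (p + z)
  let s : Set (Fin d → ℝ) := (fun z => p + z) ⁻¹' unitCube d
  let l : ℝ →L[ℝ] (Fin d → ℝ) := ContinuousLinearMap.toSpanSingleton ℝ v
  have hs : p +ᵥ s = unitCube d := by
    ext z
    simp [s, Set.mem_vadd_set_iff_neg_vadd_mem]
  have hsconv : Convex ℝ s := (convex_Icc (0 : Fin d → ℝ) 1).translate_preimage_right p
  have hsdiff : UniqueDiffOn ℝ s := by
    have hs' : s = -p +ᵥ unitCube d := by rw [← hs, neg_vadd_vadd]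
    rw [hs']
    refine uniqueDiffOn_convex ((convex_Icc (0 : Fin d → ℝ) 1).vadd (-p)) ?_
    rw [interior_vadd]
    exact (interior_unitCube_nonempty d).vadd_set
  have hF : ContDiffOn ℝ r F s := hf.1.comp (by fun_prop) fun z hz => hz
  have hsub : Icc (0 : ℝ) 1 ⊆ l ⁻¹' s := fun t ht => hp t ht
  have hldiff : UniqueDiffOn ℝ (l ⁻¹' s) :=
    uniqueDiffOn_convex (hsconv.linear_preimage l.toLinearMap)
      ((nonempty_Ioo.2 (zero_lt_one' ℝ)).mono
        (by rw [← interior_Icc]; exact interior_mono hsub))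
  have hFl : ContDiffOn ℝ r (F ∘ l) (l ⁻¹' s) := hF.comp_continuousLinearMap l
  refine ⟨hFl.mono hsub, fun t ht => ?_⟩
  have hder : iteratedDerivWithin r (F ∘ l) (Icc 0 1) t
      = h ^ r * mixedPartial (fun _ : Fin r => i) f (p + t • v) := by
    rw [iteratedDerivWithin_eq_iteratedFDerivWithin,
      iteratedFDerivWithin_subset hsub (uniqueDiffOn_Icc zero_lt_one) hldiff hFl ht,
      l.iteratedFDerivWithin_comp_right hF hsdiff hldiff (hsub ht) le_rfl,
      iteratedFDerivWithin_comp_add_left, hs]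
    have hv : (fun _ : Fin r => v)
        = fun j : Fin r => (fun _ => h) j • (Pi.single i 1 : Fin d → ℝ) := by
      funext j; simp [v, ← Pi.single_smul]
    simp only [ContinuousMultilinearMap.compContinuousLinearMap_apply, l,
      ContinuousLinearMap.toSpanSingleton_apply, one_smul]
    rw [hv, ContinuousMultilinearMap.map_smul_univ]
    simp [mixedPartial]
  change |iteratedDerivWithin r (F ∘ l) (Icc 0 1) t| ≤ _
  rw [hder, abs_mul, abs_pow]
  exact mul_le_of_le_one_right (by positivity) (hf.2 r le_rfl _ _ (hp t ht))

theorem update_mem_unitCube {d : ℕ} {x : Fin d → ℝ} (hx : x ∈ unitCube d) (i : Fin d) {s : ℝ}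
    (hs : s ∈ Icc (0 : ℝ) 1) : Function.update x i s ∈ unitCube d := by
  rw [unitCube, ← pi_univ_Icc] at *
  exact (update_mem_pi_iff_of_mem hx).2 fun _ => hs

theorem add_div_mem_Icc {M : ℕ} (a : Fin M) {s : ℝ} (hs : s ∈ Icc (0 : ℝ) 1) :
    ((a : ℝ) + s) / M ∈ Icc (0 : ℝ) 1 := by
  have hM : (0 : ℝ) < M := by exact_mod_cast a.pos
  have ha : (a : ℝ) + 1 ≤ M := by exact_mod_cast a.2
  exact ⟨div_nonneg (add_nonneg (by positivity) hs.1) hM.le,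
    (div_le_one hM).2 (by linarith [hs.2])⟩

theorem setIntegral_Icc_eq_sum_cells {M : ℕ} (hM : 1 ≤ M) {g : ℝ → ℝ}
    (hg : ContinuousOn g (Icc 0 1)) :
    ∫ s in Icc (0 : ℝ) 1, g s
      = ∑ a : Fin M, (1 / (M : ℝ)) * ∫ s in Icc (0 : ℝ) 1, g (((a : ℝ) + s) / M) := by
  have hM0 : (M : ℝ) ≠ 0 := by positivity
  have hIcc : ∀ F : ℝ → ℝ, ∫ s in Icc (0 : ℝ) 1, F s = ∫ s in (0 : ℝ)..1, F s := fun F => by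
    rw [integral_Icc_eq_integral_Ioc, intervalIntegral.integral_of_le zero_le_one]
  have hsum := intervalIntegral.sum_integral_adjacent_intervals (f := g) (μ := volume)
    (a := fun k : ℕ => (k : ℝ) / M) (n := M) fun k hk => by
      refine ContinuousOn.intervalIntegrable (hg.mono ?_)
      have h1 : (0 : ℝ) ≤ (k : ℝ) / M := by positivity
      have h2 : ((k + 1 : ℕ) : ℝ) / M ≤ 1 := by
        rw [div_le_one (by positivity)]; exact_mod_cast hk
      rw [uIcc_of_le (by gcongr; simp)]
      exact Icc_subset_Icc h1 h2
  simp only [Nat.cast_zero, zero_div, div_self hM0] at hsum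
  rw [hIcc, ← hsum, Finset.sum_range]
  refine Finset.sum_congr rfl fun a _ => ?_
  rw [hIcc]
  have h := intervalIntegral.integral_comp_div_add (a := 0) (b := 1) g hM0 ((a : ℝ) / M)
  have h' : ∀ s : ℝ, s / M + (a : ℝ) / M = (a + s) / M := fun s => by ring
  simp only [h', smul_eq_mul] at h
  rw [h]
  field_simp
  push_cast
  simp

/-- Rescaling a cell of length `1/M` to `[0,1]` multiplies the `r`-th derivative by `(1/M)^r`. The
total error is the average of the errors on the `M` cells. -/
theorem composite_rule_error_le {r d N M : ℕ} (hr : 1 ≤ r) (hM : 1 ≤ M) {w t : Fin N → ℝ}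
    (hw : ∀ i, 0 ≤ w i) (hw1 : ∑ i, w i = 1) (ht : ∀ i, t i ∈ Icc (0 : ℝ) 1)
    (hex : ∀ k < r, ∫ x in Icc (0 : ℝ) 1, x ^ k = ∑ i, w i * t i ^ k)
    {f : (Fin d → ℝ) → ℝ} (hf : f ∈ smoothClass r d) (i : Fin d) {x : Fin d → ℝ}
    (hx : x ∈ unitCube d) :
    |(∫ s in Icc (0 : ℝ) 1, f (Function.update x i s)) -
      ∑ q : Fin M × Fin N, 1 / (M : ℝ) * w q.2 *
        f (Function.update x i (((q.1 : ℝ) + t q.2) / M))| ≤ 2 * (1 / (M : ℝ)) ^ r := by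
  have hM0 : (M : ℝ) ≠ 0 := by positivity
  let g : ℝ → ℝ := fun s => f (Function.update x i s)
  have hg : ContinuousOn g (Icc 0 1) :=
    hf.1.continuousOn.comp (by fun_prop) fun s hs => update_mem_unitCube hx i hs
  have hcell : ∀ a : Fin M, |(∫ s in Icc (0 : ℝ) 1, g (((a : ℝ) + s) / M)) -
      ∑ j, w j * g (((a : ℝ) + t j) / M)| ≤ 2 * (1 / (M : ℝ)) ^ r := fun a => by
    have hup : ∀ s : ℝ, Function.update x i ((a : ℝ) / M) + s • Pi.single i (1 / (M : ℝ))
        = Function.update x i (((a : ℝ) + s) / M) := fun s => by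
      ext j
      by_cases hj : j = i
      · subst hj; simp; ring
      · simp [hj]
    obtain ⟨hc, hb⟩ := smoothClass_segment hf (p := Function.update x i ((a : ℝ) / M)) i
      (h := 1 / (M : ℝ)) fun s hs => by
        rw [hup]; exact update_mem_unitCube hx i (add_div_mem_Icc a hs)
    have h := positive_quadrature_error_le hr hw hw1 ht hex hc hb
    simp only [hup] at h
    rwa [abs_of_nonneg (by positivity : (0 : ℝ) ≤ 1 / M)] at h
  change |(∫ s in Icc (0 : ℝ) 1, g s) -
      ∑ q : Fin M × Fin N, 1 / (M : ℝ) * w q.2 * g (((q.1 : ℝ) + t q.2) / M)| ≤ _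
  rw [setIntegral_Icc_eq_sum_cells hM hg, Fintype.sum_prod_type, ← Finset.sum_sub_distrib]
  refine (Finset.abs_sum_le_sum_abs _ _).trans ?_
  calc _ ≤ ∑ _a : Fin M, 1 / (M : ℝ) * (2 * (1 / (M : ℝ)) ^ r) := Finset.sum_le_sum fun a _ => by
        simp only [mul_assoc]
        rw [← Finset.mul_sum, ← mul_sub, abs_mul, abs_of_nonneg (by positivity : (0 : ℝ) ≤ 1 / M)]
        exact mul_le_mul_of_nonneg_left (hcell a) (by positivity)
    _ = _ := by
        simp only [Finset.sum_const, Finset.card_univ, Fintype.card_fin, nsmul_eq_mul]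
        field_simp

/-! ### Fubini on the cube and tensor product rules. -/

theorem cons_mem_unitCube {d : ℕ} {s : ℝ} {y : Fin d → ℝ} :
    (Fin.cons s y : Fin (d + 1) → ℝ) ∈ unitCube (d + 1) ↔ s ∈ Icc (0 : ℝ) 1 ∧ y ∈ unitCube d := by
  simp only [unitCube, mem_Icc, Pi.le_def, Fin.forall_fin_succ, Fin.cons_zero, Fin.cons_succ,
    Pi.zero_apply, Pi.one_apply]
  tauto

theorem volume_unitCube (d : ℕ) : volume (unitCube d) = 1 := by
  simp [unitCube, Real.volume_Icc_pi]

theorem isCompact_unitCube (d : ℕ) : IsCompact (unitCube d) := isCompact_Icc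

theorem cubeIntegral_succ {d : ℕ} {g : (Fin (d + 1) → ℝ) → ℝ}
    (hg : ContinuousOn g (unitCube (d + 1))) :
    IntegrableOn (fun y : Fin d → ℝ => ∫ s in Icc (0 : ℝ) 1, g (Fin.cons s y)) (unitCube d) ∧
    cubeIntegral (d + 1) g = ∫ y in unitCube d, ∫ s in Icc (0 : ℝ) 1, g (Fin.cons s y) := by
  have hmp := (volume_preserving_piFinSuccAbove (fun _ : Fin (d + 1) => ℝ) 0).symm
  have hemb := (MeasurableEquiv.piFinSuccAbove (fun _ : Fin (d + 1) => ℝ) 0).symm.measurableEmbedding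
  have hpre : (MeasurableEquiv.piFinSuccAbove (fun _ : Fin (d + 1) => ℝ) 0).symm ⁻¹'
      unitCube (d + 1) = Icc (0 : ℝ) 1 ×ˢ unitCube d := by
    ext ⟨s, y⟩
    simp [MeasurableEquiv.piFinSuccAbove_symm_apply, Fin.insertNthEquiv, cons_mem_unitCube]
  have hint : IntegrableOn (fun z : ℝ × (Fin d → ℝ) => g (Fin.cons z.1 z.2))
      (Icc (0 : ℝ) 1 ×ˢ unitCube d) := by
    refine ContinuousOn.integrableOn_compact (isCompact_Icc.prod (isCompact_unitCube d)) ?_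
    exact hg.comp (by fun_prop) fun z hz => cons_mem_unitCube.2 hz
  rw [IntegrableOn, Measure.volume_eq_prod, ← Measure.prod_restrict] at hint
  refine ⟨hint.integral_prod_right, ?_⟩
  rw [← integral_prod_symm _ hint, Measure.prod_restrict, ← Measure.volume_eq_prod, cubeIntegral,
    ← hmp.setIntegral_preimage_emb hemb, hpre]
  simp [MeasurableEquiv.piFinSuccAbove_symm_apply, Fin.insertNthEquiv]

/-- The error of a tensor product of positive quadrature rules is at most the sum of the
one-dimensional errors. -/
theorem product_rule_error_le {ι : Type*} [Fintype ι] {w t : ι → ℝ} (hw : ∀ i, 0 ≤ w i)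
    (hw1 : ∑ i, w i = 1) (ht : ∀ i, t i ∈ Icc (0 : ℝ) 1) {ε : ℝ} (d : ℕ)
    {g : (Fin d → ℝ) → ℝ} (hg : ContinuousOn g (unitCube d))
    (hε : ∀ i, ∀ x ∈ unitCube d, |(∫ s in Icc (0 : ℝ) 1, g (Function.update x i s)) -
      ∑ q, w q * g (Function.update x i (t q))| ≤ ε) :
    |cubeIntegral d g - ∑ κ : Fin d → ι, (∏ j, w (κ j)) * g (fun j => t (κ j))| ≤ d * ε := by
  induction d with
  | zero =>
    have h : unitCube 0 = univ := by
      ext x; simp [unitCube, Subsingleton.elim x 0]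
    have h1 : volume (univ : Set (Fin 0 → ℝ)) = 1 := h ▸ volume_unitCube 0
    simp only [cubeIntegral, h, Measure.restrict_univ, integral_unique, Measure.real, h1]
    simp [sub_eq_zero]
    exact congrArg g (Subsingleton.elim _ _)
  | succ d ih =>
    obtain ⟨hint, hcube⟩ := cubeIntegral_succ hg
    have hcont : ∀ q, ContinuousOn (fun y : Fin d → ℝ => g (Fin.cons (t q) y)) (unitCube d) :=
      fun q => hg.comp (by fun_prop) fun y hy => cons_mem_unitCube.2 ⟨ht q, hy⟩
    have hconti : ∀ q, IntegrableOn (fun y : Fin d → ℝ => g (Fin.cons (t q) y)) (unitCube d) :=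
      fun q => (hcont q).integrableOn_compact (isCompact_unitCube d)
    have hslice : ∀ q, |cubeIntegral d (fun y => g (Fin.cons (t q) y)) -
        ∑ κ : Fin d → ι, (∏ j, w (κ j)) * g (Fin.cons (t q) fun j => t (κ j))| ≤ d * ε := fun q =>
      ih (hcont q) fun i x hx => by
        have h := hε i.succ _ (cons_mem_unitCube.2 ⟨ht q, hx⟩)
        simpa only [← Fin.cons_update] using h
    have hfst : |∫ y in unitCube d, ((∫ s in Icc (0 : ℝ) 1, g (Fin.cons s y)) -
        ∑ q, w q * g (Fin.cons (t q) y))| ≤ ε := by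
      have h := norm_setIntegral_le_of_norm_le_const (μ := volume) (C := ε)
        (by simp [volume_unitCube] : volume (unitCube d) < ⊤)
        (f := fun y => (∫ s in Icc (0 : ℝ) 1, g (Fin.cons s y)) - ∑ q, w q * g (Fin.cons (t q) y))
        fun y hy => by
          -- The first coordinate is overwritten by the update, so its value `0` here is immaterial.
          have h := hε 0 _ (cons_mem_unitCube.2 ⟨left_mem_Icc.2 zero_le_one, hy⟩)
          simpa only [Fin.update_cons_zero, ← Real.norm_eq_abs] using h
      simpa [Measure.real, volume_unitCube] using h
    have hsum : ∑ κ : Fin (d + 1) → ι, (∏ j, w (κ j)) * g (fun j => t (κ j))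
        = ∑ q, w q * ∑ κ : Fin d → ι, (∏ j, w (κ j)) * g (Fin.cons (t q) fun j => t (κ j)) := by
      rw [← (Fin.consEquiv fun _ : Fin (d + 1) => ι).sum_comp, Fintype.sum_prod_type]
      refine Finset.sum_congr rfl fun q _ => ?_
      rw [Finset.mul_sum]
      refine Finset.sum_congr rfl fun κ _ => ?_
      have : (fun j => t ((Fin.cons q κ : Fin (d + 1) → ι) j))
          = (Fin.cons (t q) fun j => t (κ j) : Fin (d + 1) → ℝ) := by
        ext j; refine Fin.cases ?_ (fun j => ?_) j <;> simp
      simp only [Fin.consEquiv_apply, Fin.prod_univ_succ, Fin.cons_zero, Fin.cons_succ, this]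
      ring
    -- Telescoping: the rule first replaces the integral in the first variable, at cost `ε`; then
    -- the `d`-dimensional error is averaged over the slices.
    have hsplit : cubeIntegral (d + 1) g - ∑ κ : Fin (d + 1) → ι, (∏ j, w (κ j)) *
          g (fun j => t (κ j))
        = (∫ y in unitCube d, ((∫ s in Icc (0 : ℝ) 1, g (Fin.cons s y)) -
            ∑ q, w q * g (Fin.cons (t q) y))) +
          ∑ q, w q * (cubeIntegral d (fun y => g (Fin.cons (t q) y)) -
            ∑ κ : Fin d → ι, (∏ j, w (κ j)) * g (Fin.cons (t q) fun j => t (κ j))) := by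
      rw [integral_sub hint (integrable_finsetSum _ fun q _ => (hconti q).const_mul _),
        integral_finsetSum _ fun q _ => (hconti q).const_mul _, hcube, hsum]
      simp only [integral_const_mul, mul_sub, Finset.sum_sub_distrib, cubeIntegral]
      ring
    have hsnd : |∑ q, w q * (cubeIntegral d (fun y => g (Fin.cons (t q) y)) -
            ∑ κ : Fin d → ι, (∏ j, w (κ j)) * g (Fin.cons (t q) fun j => t (κ j)))| ≤ d * ε := by
      calc _ ≤ ∑ q, w q * (d * ε) := (Finset.abs_sum_le_sum_abs _ _).trans
            (Finset.sum_le_sum fun q _ => by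
              rw [abs_mul, abs_of_nonneg (hw q)]
              exact mul_le_mul_of_nonneg_left (hslice q) (hw q))
        _ = d * ε := by rw [← Finset.sum_mul, hw1, one_mul]
    rw [hsplit]
    refine (abs_add_le _ _).trans ((add_le_add hfst hsnd).trans (le_of_eq ?_))
    push_cast; ring

/-! ### Linear algorithms and the upper bound. -/

/-- The nonadaptive algorithm with given sample points and output map. -/
noncomputable def SamplingAlgorithm.ofPoints {d n : ℕ} (p : Fin n → unitCube d)
    (φ : (Fin n → ℝ) → ℝ) : SamplingAlgorithm d n where
  point k _ := if h : k < n then p ⟨k, h⟩ else ⟨0, by simp [unitCube]⟩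
  output := φ

theorem SamplingAlgorithm.run_ofPoints {d n : ℕ} (p : Fin n → unitCube d) (φ : (Fin n → ℝ) → ℝ)
    (f : (Fin d → ℝ) → ℝ) :
    (SamplingAlgorithm.ofPoints p φ).run f = φ fun i => f (p i) := by
  have h : ∀ k, ∀ hk : k ≤ n, (SamplingAlgorithm.ofPoints p φ).info f k
      = fun i => f (p (Fin.castLE hk i)) := by
    intro k
    induction k with
    | zero => intro _; exact funext fun i => i.elim0
    | succ k ih =>
      intro hk
      funext i
      refine Fin.lastCases ?_ (fun i => ?_) i
      · simp only [SamplingAlgorithm.info, Fin.snoc_last, SamplingAlgorithm.ofPoints]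
        rw [dif_pos (by omega)]
        rfl
      · simp only [SamplingAlgorithm.info, Fin.snoc_castSucc, ih (by omega)]
        rfl
  change φ _ = _
  rw [h n le_rfl]
  rfl

theorem abs_le_one_of_mem_smoothClass {r d : ℕ} {f : (Fin d → ℝ) → ℝ} (hf : f ∈ smoothClass r d)
    {x : Fin d → ℝ} (hx : x ∈ unitCube d) : |f x| ≤ 1 := by
  simpa [mixedPartial] using hf.2 0 (Nat.zero_le r) Fin.elim0 x hx

theorem minimalError_le_of_linear {r d n : ℕ} {ι : Type*} [Fintype ι] (hcard : Fintype.card ι ≤ n)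
    {W : ι → ℝ} {X : ι → Fin d → ℝ} (hX : ∀ κ, X κ ∈ unitCube d) {ε : ℝ}
    (h : ∀ f ∈ smoothClass r d, |cubeIntegral d f - ∑ κ, W κ * f (X κ)| ≤ ε) :
    minimalError r d n ≤ ENNReal.ofReal ε := by
  obtain ⟨e⟩ := Function.Embedding.nonempty_of_card_le (α := ι) (β := Fin n)
    (by rwa [Fintype.card_fin])
  -- Surplus sample points are put at the origin and their values ignored by the output.
  let p : Fin n → unitCube d :=
    Function.extend e (fun κ => ⟨X κ, hX κ⟩) fun _ => ⟨0, by simp [unitCube]⟩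
  refine (iInf_le _ (SamplingAlgorithm.ofPoints p fun y => ∑ κ, W κ * y (e κ))).trans ?_
  refine iSup₂_le fun f hf => ENNReal.ofReal_le_ofReal ?_
  rw [SamplingAlgorithm.run_ofPoints]
  simpa [p, e.injective.extend_apply] using h f hf

theorem minimalError_le_one (r d n : ℕ) : minimalError r d n ≤ ENNReal.ofReal 1 := by
  refine minimalError_le_of_linear (ι := Fin 0) (W := 0) (X := 0) (by simp) (fun κ => κ.elim0)
    fun f hf => ?_
  have h := norm_setIntegral_le_of_norm_le_const (μ := volume) (C := 1) (f := f)
    (by simp [volume_unitCube] : volume (unitCube d) < ⊤)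
    fun x hx => abs_le_one_of_mem_smoothClass hf hx
  simpa [cubeIntegral, Measure.real, volume_unitCube] using h

theorem exists_minimalError_le (r : ℕ) (hr : 1 ≤ r) :
    ∃ c : ℝ, 0 < c ∧ ∀ d n m : ℕ, 1 ≤ d → 1 ≤ m → m ^ d ≤ n →
      minimalError r d n ≤ ENNReal.ofReal (min 1 (c * d * (1 / (m : ℝ)) ^ r)) := by
  obtain ⟨N, w, t, hw, hw1, ht, hex⟩ := exists_positive_quadrature r
  have hN : 1 ≤ N := by
    rcases Nat.eq_zero_or_pos N with rfl | h
    · simp at hw1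
    · exact h
  -- For `m ≥ N`, the choice `M = ⌊m/N⌋` gives `M N ≤ m` and `1/M ≤ 2N/m`. For `m < N` not even one
  -- cell is affordable, but then this constant makes the claimed bound trivial.
  refine ⟨2 * (2 * N) ^ r, by positivity, fun d n m hd hm hmn => ?_⟩
  rw [ENNReal.ofReal_min]
  refine le_min (minimalError_le_one r d n) ?_
  have hm0 : (0 : ℝ) < m := by exact_mod_cast hm
  have hd1 : (1 : ℝ) ≤ d := by exact_mod_cast hd
  rcases lt_or_ge m N with hlt | hge
  · refine (minimalError_le_one r d n).trans (ENNReal.ofReal_le_ofReal ?_)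
    have hlt' : (m : ℝ) ≤ N := by exact_mod_cast hlt.le
    have h1 : (1 : ℝ) ≤ (2 * N * (1 / (m : ℝ))) ^ r := by
      refine one_le_pow₀ ?_
      rw [mul_one_div, le_div_iff₀ hm0]
      linarith
    calc (1 : ℝ) ≤ 2 * 1 * (2 * N * (1 / (m : ℝ))) ^ r := by linarith
      _ ≤ 2 * d * (2 * N * (1 / (m : ℝ))) ^ r := by gcongr
      _ = _ := by rw [mul_pow]; ring
  · let M := m / N
    have hM : 1 ≤ M := (Nat.one_le_div_iff hN).2 hge
    have hMN : M * N ≤ m := Nat.div_mul_le_self m N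
    have hM0 : (0 : ℝ) < M := by exact_mod_cast hM
    have hM2 : (m : ℝ) ≤ 2 * N * M := by
      have h1 : m < N * (M + 1) := Nat.lt_mul_div_succ m hN
      have h2 : N * (M + 1) ≤ N * (2 * M) := Nat.mul_le_mul_left N (by omega)
      have h3 : m ≤ 2 * N * M := by nlinarith
      exact_mod_cast h3
    let W : Fin M × Fin N → ℝ := fun q => 1 / (M : ℝ) * w q.2
    let T : Fin M × Fin N → ℝ := fun q => ((q.1 : ℝ) + t q.2) / M
    have hT : ∀ q, T q ∈ Icc (0 : ℝ) 1 := fun q => add_div_mem_Icc q.1 (ht q.2)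
    have hW1 : ∑ q, W q = 1 := by
      rw [Fintype.sum_prod_type]
      simp only [W, ← Finset.mul_sum, hw1]
      simp [hM0.ne']
    refine (minimalError_le_of_linear (ι := Fin d → Fin M × Fin N)
      (W := fun κ => ∏ j, W (κ j)) (X := fun κ j => T (κ j)) (ε := d * (2 * (1 / (M : ℝ)) ^ r))
      ?_ (fun κ => ?_) fun f hf => ?_).trans (ENNReal.ofReal_le_ofReal ?_)
    · simp only [Fintype.card_fun, Fintype.card_prod, Fintype.card_fin]
      exact (Nat.pow_le_pow_left hMN d).trans hmn
    · exact ⟨fun j => (hT _).1, fun j => (hT _).2⟩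
    · exact product_rule_error_le (fun q => mul_nonneg (by positivity) (hw _)) hW1 hT d
        hf.1.continuousOn fun i x hx => composite_rule_error_le hr hM hw hw1 ht hex hf i hx
    · have h1 : 1 / (M : ℝ) ≤ 2 * N * (1 / m) := by
        rw [mul_one_div, div_le_div_iff₀ hM0 hm0]
        linarith
      calc (d : ℝ) * (2 * (1 / (M : ℝ)) ^ r) ≤ d * (2 * (2 * N * (1 / m)) ^ r) := by gcongr
        _ = _ := by rw [mul_pow]; ring

/-! ### Smooth kernels and mollification. -/

open scoped ContDiff

theorem hasCompactSupport_iterate_deriv {φ : ℝ → ℝ} (hφ : HasCompactSupport φ) (k : ℕ) :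
    HasCompactSupport (deriv^[k] φ) := by
  induction k with
  | zero => exact hφ
  | succ k ih => rw [Function.iterate_succ_apply']; exact ih.deriv

/-- Rescaling one fixed bump multiplies the `L¹` norm of its `k`-th derivative by `δ^{-k}`. It
matters that `C` does not depend on `δ` and that the bound is exactly `1` for `k = 0`: products of
`d` such kernels then acquire no constant growing with `d`. -/
theorem exists_smooth_kernel (r : ℕ) :
    ∃ C : ℝ, 1 ≤ C ∧ ∀ δ : ℝ, 0 < δ → ∃ ψ : ℝ → ℝ, ContDiff ℝ ∞ ψ ∧ HasCompactSupport ψ ∧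
      (∀ t, 0 ≤ ψ t) ∧ ∫ t, ψ t = 1 ∧ (∀ t, δ < |t| → ψ t = 0) ∧
      ∀ k ≤ r, ∫ t, |deriv^[k] ψ t| ≤ (C / δ) ^ k := by
  let b : ContDiffBump (0 : ℝ) := ⟨1 / 2, 1, by norm_num, by norm_num⟩
  let φ : ℝ → ℝ := b.normed volume
  have hφ : ContDiff ℝ ∞ φ := b.contDiff_normed
  have hφ0 : ∀ t, 0 ≤ φ t := b.nonneg_normed
  have hφ1 : ∫ t, φ t = 1 := b.integral_normed
  let C : ℝ := 1 + ∑ k ∈ Finset.range (r + 1), ∫ t, |deriv^[k] φ t|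
  have hnn : ∀ k, 0 ≤ ∫ t, |deriv^[k] φ t| := fun k => integral_nonneg fun t => abs_nonneg _
  have hC1 : 1 ≤ C := le_add_of_nonneg_right (Finset.sum_nonneg fun k _ => hnn k)
  have hC : ∀ k ≤ r, ∫ t, |deriv^[k] φ t| ≤ C ^ k := fun k hk => by
    rcases Nat.eq_zero_or_pos k with rfl | hk0
    · simp only [Function.iterate_zero, id, abs_of_nonneg (hφ0 _), hφ1, pow_zero, le_refl]
    · have h1 : ∫ t, |deriv^[k] φ t| ≤ C := by
        have := Finset.single_le_sum (f := fun k => ∫ t, |deriv^[k] φ t|) (fun k _ => hnn k)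
          (Finset.mem_range.2 (Nat.lt_succ_of_le hk))
        simp only [C]; linarith
      exact h1.trans (le_self_pow₀ hC1 (by omega))
  refine ⟨C, hC1, fun δ hδ => ?_⟩
  let ψ : ℝ → ℝ := fun t => δ⁻¹ * φ (δ⁻¹ * t)
  have hzero : ∀ t, δ < |t| → ψ t = 0 := fun t ht => by
    have : δ⁻¹ * t ∉ Function.support φ := by
      rw [b.support_normed_eq, mem_ball_zero_iff, Real.norm_eq_abs, abs_mul,
        abs_of_pos (inv_pos.2 hδ), not_lt, inv_mul_eq_div, le_div_iff₀ hδ]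
      linarith
    simp only [ψ, Function.notMem_support.1 this, mul_zero]
  have hder : ∀ k t, deriv^[k] ψ t = δ⁻¹ ^ k * (δ⁻¹ * deriv^[k] φ (δ⁻¹ * t)) := fun k t => by
    have hd : deriv^[k] ψ t = iteratedDeriv k ψ t := by rw [iteratedDeriv_eq_iterate]
    rw [hd]
    have h1 := congrFun (iteratedDeriv_comp_const_mul (n := k)
      (hφ.of_le (by exact_mod_cast le_top)) δ⁻¹) t
    simp only [ψ]
    rw [iteratedDeriv_const_mul_field, h1, iteratedDeriv_eq_iterate]
    ring
  have hscale : ∀ g : ℝ → ℝ, ∫ t, δ⁻¹ * g (δ⁻¹ * t) = ∫ t, g t := fun g => by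
    rw [integral_const_mul, Measure.integral_comp_mul_left, inv_inv, abs_of_pos hδ, smul_eq_mul,
      inv_mul_cancel_left₀ hδ.ne']
  refine ⟨ψ, by fun_prop, ?_, fun t => mul_nonneg (inv_pos.2 hδ).le (hφ0 _), ?_, hzero,
    fun k hk => ?_⟩
  · refine HasCompactSupport.intro (isCompact_Icc (a := -δ) (b := δ)) fun t ht => hzero t ?_
    rw [mem_Icc, ← abs_le, not_le] at ht
    exact ht
  · rw [← hφ1]; exact hscale φ
  · have h1 : ∀ t, |deriv^[k] ψ t| = δ⁻¹ ^ k * (δ⁻¹ * |deriv^[k] φ (δ⁻¹ * t)|) := fun t => by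
      rw [hder, abs_mul, abs_mul, abs_of_pos (pow_pos (inv_pos.2 hδ) k),
        abs_of_pos (inv_pos.2 hδ)]
    simp only [h1]
    rw [integral_const_mul, hscale fun t => |deriv^[k] φ t|, div_eq_inv_mul, mul_pow]
    exact mul_le_mul_of_nonneg_left (hC k hk) (by positivity)

/-- The partial derivative with multi-index `β` of `x ↦ ∏ j, ψ (x j)`. -/
noncomputable def prodKernel {d : ℕ} (ψ : ℝ → ℝ) (β : Fin d → ℕ) (x : Fin d → ℝ) : ℝ :=
  ∏ j, deriv^[β j] ψ (x j)

section prodKernel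

variable {d : ℕ} {ψ : ℝ → ℝ}

theorem contDiff_prodKernel (h : ContDiff ℝ ∞ ψ) (β : Fin d → ℕ) :
    ContDiff ℝ ∞ (prodKernel ψ β) :=
  contDiff_prod fun j _ => (h.iterate_deriv (β j)).comp (contDiff_apply ℝ ℝ j)

theorem hasCompactSupport_prodKernel (hψ : HasCompactSupport ψ) (β : Fin d → ℕ) :
    HasCompactSupport (prodKernel ψ β) := by
  refine HasCompactSupport.intro
    (isCompact_univ_pi fun j => hasCompactSupport_iterate_deriv hψ (β j)) fun x hx => ?_
  simp only [mem_univ_pi, not_forall] at hx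
  obtain ⟨j, hj⟩ := hx
  exact Finset.prod_eq_zero (Finset.mem_univ j) (image_eq_zero_of_notMem_tsupport hj)

theorem integrable_prodKernel (h : ContDiff ℝ ∞ ψ) (hψ : HasCompactSupport ψ) (β : Fin d → ℕ) :
    Integrable (prodKernel ψ β) :=
  (contDiff_prodKernel h β).continuous.integrable_of_hasCompactSupport
    (hasCompactSupport_prodKernel hψ β)

theorem fderiv_prodKernel_single (h : ContDiff ℝ ∞ ψ) (β : Fin d → ℕ) (i : Fin d)
    (x : Fin d → ℝ) :
    fderiv ℝ (prodKernel ψ β) x (Pi.single i 1) = prodKernel ψ (β + Pi.single i 1) x := by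
  have h1 : ∀ j ∈ Finset.univ, HasFDerivAt (fun x : Fin d → ℝ => deriv^[β j] ψ (x j))
      (deriv^[β j + 1] ψ (x j) • (ContinuousLinearMap.proj j : (Fin d → ℝ) →L[ℝ] ℝ)) x :=
    fun j _ => by
      have hd : HasDerivAt (deriv^[β j] ψ) (deriv^[β j + 1] ψ (x j)) (x j) := by
        rw [Function.iterate_succ_apply']
        exact ((h.iterate_deriv (β j)).differentiable (by simp) _).hasDerivAt
      exact hd.comp_hasFDerivAt x (hasFDerivAt_apply j x)
  have h2 := (HasFDerivAt.finsetProd h1).fderiv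
  change fderiv ℝ (fun x => ∏ j, deriv^[β j] ψ (x j)) x _ = _
  rw [h2, sum_apply, Finset.sum_eq_single i]
  · rw [prodKernel, ← Finset.prod_erase_mul _ _ (Finset.mem_univ i)]
    simp only [smul_apply, ContinuousLinearMap.proj_apply, Pi.single_eq_same,
      smul_eq_mul, mul_one, Pi.add_apply]
    congr 1
    refine Finset.prod_congr rfl fun j hj => ?_
    rw [Pi.single_eq_of_ne (Finset.ne_of_mem_erase hj), add_zero]
  · intro j _ hj
    simp [Pi.single_eq_of_ne hj]
  · simp

/-- The integral factorizes, and factors with `β j = 0` contribute at most `1`; only the order of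
the derivative counts, not the dimension. -/
theorem integral_abs_prodKernel_le {B : ℝ} {r : ℕ} (hB : ∀ k ≤ r, ∫ t, |deriv^[k] ψ t| ≤ B ^ k)
    (β : Fin d → ℕ) (hβ : ∑ j, β j ≤ r) :
    ∫ x, |prodKernel ψ β x| ≤ B ^ ∑ j, β j := by
  simp only [prodKernel, Finset.abs_prod]
  rw [integral_fintype_prod_volume_eq_prod (fun j t => |deriv^[β j] ψ t|),
    ← Finset.prod_pow_eq_pow_sum]
  exact Finset.prod_le_prod (fun j _ => integral_nonneg fun t => abs_nonneg _) fun j _ =>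
    hB _ ((Finset.single_le_sum (fun _ _ => Nat.zero_le _) (Finset.mem_univ j)).trans hβ)

end prodKernel

open scoped Convolution in
/-- The convolution of `f` with a partial derivative of the product kernel. -/
noncomputable def mollify {d : ℕ} (f : (Fin d → ℝ) → ℝ) (ψ : ℝ → ℝ) (β : Fin d → ℕ) :
    (Fin d → ℝ) → ℝ :=
  f ⋆[ContinuousLinearMap.mul ℝ ℝ, volume] prodKernel ψ β

section mollify

variable {d : ℕ} {f : (Fin d → ℝ) → ℝ} {ψ : ℝ → ℝ}

theorem mollify_apply (β : Fin d → ℕ) (x : Fin d → ℝ) :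
    mollify f ψ β x = ∫ t, f (x - t) * prodKernel ψ β t := by
  rw [mollify, convolution_eq_swap]
  rfl

theorem contDiff_mollify (hf : Continuous f) (h : ContDiff ℝ ∞ ψ) (hψ : HasCompactSupport ψ)
    (β : Fin d → ℕ) : ContDiff ℝ ∞ (mollify f ψ β) :=
  (hasCompactSupport_prodKernel hψ β).contDiff_convolution_right _ hf.locallyIntegrable
    (contDiff_prodKernel h β)

theorem fderiv_mollify_single (hf : Continuous f) (h : ContDiff ℝ ∞ ψ) (hψ : HasCompactSupport ψ)
    (β : Fin d → ℕ) (i : Fin d) (x : Fin d → ℝ) :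
    fderiv ℝ (mollify f ψ β) x (Pi.single i 1) = mollify f ψ (β + Pi.single i 1) x := by
  have hK := contDiff_prodKernel (d := d) h β
  have hKc := hasCompactSupport_prodKernel (d := d) hψ β
  have hd := (hKc.hasFDerivAt_convolution_right (ContinuousLinearMap.mul ℝ ℝ)
    (μ := volume) hf.locallyIntegrable (hK.of_le (by exact_mod_cast le_top)) x).fderiv
  rw [mollify, hd, convolution_precompR_apply _ hf.locallyIntegrable (hKc.fderiv ℝ)
    (hK.continuous_fderiv (by simp))]
  simp only [fderiv_prodKernel_single h]
  rfl

theorem exists_iteratedFDeriv_mollify_eq (hf : Continuous f) (h : ContDiff ℝ ∞ ψ)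
    (hψ : HasCompactSupport ψ) {k : ℕ} (w : Fin k → Fin d) :
    ∃ β : Fin d → ℕ, ∑ j, β j = k ∧ ∀ x,
      iteratedFDeriv ℝ k (mollify f ψ 0) x (fun i => Pi.single (w i) 1) = mollify f ψ β x := by
  induction k with
  | zero => exact ⟨0, by simp, fun x => by simp⟩
  | succ k ih =>
    obtain ⟨β, hβ, hx⟩ := ih (Fin.tail w)
    refine ⟨β + Pi.single (w 0) 1, by simp [Finset.sum_add_distrib, hβ], fun x => ?_⟩
    rw [iteratedFDeriv_succ_apply_left, ← fderiv_mollify_single hf h hψ,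
      ← fderiv_continuousMultilinear_apply_const_apply]
    · exact congrArg (fun F => fderiv ℝ F x (Pi.single (w 0) 1)) (funext hx)
    · exact (contDiff_mollify hf h hψ 0).differentiable_iteratedFDeriv
        (by exact_mod_cast ENat.natCast_lt_top k) x

theorem integrable_mollify_integrand {M : ℝ} (hf : Continuous f) (hM : ∀ x, |f x| ≤ M)
    (h : ContDiff ℝ ∞ ψ) (hψ : HasCompactSupport ψ) (β : Fin d → ℕ) (x : Fin d → ℝ) :
    Integrable fun t => f (x - t) * prodKernel ψ β t :=
  (integrable_prodKernel h hψ β).bdd_mul (c := M)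
    (by fun_prop : Continuous fun t => f (x - t)).aestronglyMeasurable
    (Filter.Eventually.of_forall fun t => hM _)

/-- Here the extra derivative is charged to `f`: difference quotients of the convolution are
convolutions of difference quotients of `f`, which are bounded by `L`. -/
theorem abs_fderiv_mollify_single_le {M L : ℝ} (hf : Continuous f) (hM : ∀ x, |f x| ≤ M)
    (hL0 : 0 ≤ L) (hL : ∀ x i s, |f (x + s • Pi.single i 1) - f x| ≤ L * |s|)
    (h : ContDiff ℝ ∞ ψ) (hψ : HasCompactSupport ψ) (β : Fin d → ℕ) (i : Fin d)
    (x : Fin d → ℝ) :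
    |fderiv ℝ (mollify f ψ β) x (Pi.single i 1)| ≤ L * ∫ t, |prodKernel ψ β t| := by
  have hI : 0 ≤ ∫ t, |prodKernel ψ β t| := integral_nonneg fun t => abs_nonneg _
  have hd : HasDerivAt (fun s : ℝ => mollify f ψ β (x + s • Pi.single i 1))
      (fderiv ℝ (mollify f ψ β) x (Pi.single i 1)) 0 := by
    have h1 : HasFDerivAt (mollify f ψ β) (fderiv ℝ (mollify f ψ β) x) x :=
      ((contDiff_mollify hf h hψ β).differentiable (by simp) x).hasFDerivAt
    exact h1.hasLineDerivAt (Pi.single i 1)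
  refine hd.le_of_lip' (mul_nonneg hL0 hI) (Filter.Eventually.of_forall fun s => ?_)
  simp only [zero_smul, add_zero, sub_zero, Real.norm_eq_abs]
  rw [mollify_apply, mollify_apply, ← integral_sub (integrable_mollify_integrand hf hM h hψ β _)
    (integrable_mollify_integrand hf hM h hψ β _)]
  have hb : ∀ t, ‖f (x + s • Pi.single i 1 - t) * prodKernel ψ β t
      - f (x - t) * prodKernel ψ β t‖ ≤ L * |s| * |prodKernel ψ β t| := fun t => by
    rw [← sub_mul, Real.norm_eq_abs, abs_mul, add_sub_right_comm]
    exact mul_le_mul_of_nonneg_right (hL _ _ _) (abs_nonneg _)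
  refine (norm_integral_le_of_norm_le ((integrable_prodKernel h hψ β).abs.const_mul _)
    (Filter.Eventually.of_forall hb)).trans (le_of_eq ?_)
  rw [integral_const_mul]
  ring

theorem integral_prodKernel_zero (h1 : ∫ t, ψ t = 1) :
    ∫ x : Fin d → ℝ, prodKernel ψ 0 x = 1 := by
  simp only [prodKernel, Pi.zero_apply, Function.iterate_zero, id]
  rw [integral_fintype_prod_volume_eq_prod fun _ t => ψ t]
  simp [h1]

theorem prodKernel_zero_nonneg (h0 : ∀ t, 0 ≤ ψ t) (x : Fin d → ℝ) : 0 ≤ prodKernel ψ 0 x :=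
  Finset.prod_nonneg fun _ _ => h0 _

theorem sum_abs_le_of_prodKernel_zero_ne_zero {δ : ℝ} (hδ : ∀ t, δ < |t| → ψ t = 0)
    {x : Fin d → ℝ} (hx : prodKernel ψ 0 x ≠ 0) : ∑ j, |x j| ≤ d * δ := by
  have h : ∀ j, |x j| ≤ δ := fun j => by
    by_contra! hj
    exact hx (Finset.prod_eq_zero (Finset.mem_univ j) (by simpa using hδ _ hj))
  simpa using Finset.sum_le_card_nsmul Finset.univ (fun j => |x j|) δ fun j _ => h j

/-- The outermost derivative costs `L` and each of the remaining ones, at most `r - 1`, costs a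
factor `B` through the kernel. As `B ≥ 1`, order `r` is the worst case. -/
theorem mollify_mem_smoothClass {r : ℕ} {B L : ℝ} (hf : Continuous f) (hM : ∀ x, |f x| ≤ 1)
    (hL0 : 0 ≤ L) (hL : ∀ x i s, |f (x + s • Pi.single i 1) - f x| ≤ L * |s|)
    (h : ContDiff ℝ ∞ ψ) (hψ : HasCompactSupport ψ) (h0 : ∀ t, 0 ≤ ψ t) (h1 : ∫ t, ψ t = 1)
    (hB1 : 1 ≤ B) (hB : ∀ k ≤ r, ∫ t, |deriv^[k] ψ t| ≤ B ^ k) (hLB : L * B ^ (r - 1) ≤ 1) :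
    mollify f ψ 0 ∈ smoothClass r d := by
  have hsmooth := contDiff_mollify hf h hψ 0
  refine ⟨(hsmooth.of_le (by exact_mod_cast le_top)).contDiffOn, fun k hk w x hx => ?_⟩
  rw [mixedPartial, iteratedFDerivWithin_eq_iteratedFDeriv (uniqueDiffOn_unitCube d)
    (hsmooth.of_le (by exact_mod_cast le_top)).contDiffAt hx]
  cases k with
  | zero =>
    rw [iteratedFDeriv_zero_apply, mollify_apply, ← integral_prodKernel_zero (d := d) h1]
    have hb : ∀ t, ‖f (x - t) * prodKernel ψ 0 t‖ ≤ prodKernel ψ 0 t := fun t => by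
      rw [Real.norm_eq_abs, abs_mul, abs_of_nonneg (prodKernel_zero_nonneg h0 t)]
      exact mul_le_of_le_one_left (prodKernel_zero_nonneg h0 t) (hM _)
    exact norm_integral_le_of_norm_le (integrable_prodKernel h hψ 0)
      (Filter.Eventually.of_forall hb)
  | succ k =>
    obtain ⟨β, hβ, hx⟩ := exists_iteratedFDeriv_mollify_eq hf h hψ (Fin.tail w)
    rw [iteratedFDeriv_succ_apply_left, ← fderiv_continuousMultilinear_apply_const_apply
      (hsmooth.differentiable_iteratedFDeriv (by exact_mod_cast ENat.natCast_lt_top k) x)]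
    have he : (fun y => iteratedFDeriv ℝ k (mollify f ψ 0) y
        (Fin.tail fun i => (Pi.single (w i) 1 : Fin d → ℝ))) = mollify f ψ β := funext fun y => hx y
    rw [he]
    calc _ ≤ L * ∫ t, |prodKernel ψ β t| := abs_fderiv_mollify_single_le hf hM hL0 hL h hψ β _ x
      _ ≤ L * B ^ k := by
        refine mul_le_mul_of_nonneg_left ?_ hL0
        simpa only [hβ] using integral_abs_prodKernel_le hB β (by omega)
      _ ≤ L * B ^ (r - 1) := mul_le_mul_of_nonneg_left (pow_le_pow_right₀ hB1 (by omega)) hL0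
      _ ≤ 1 := hLB

end mollify

/-! ### Fooling functions. -/

/-- A function with small first differences in the coordinate directions which vanishes near the
given points, in the `ℓ¹` distance, and is large away from them. -/
theorem exists_truncated_distance {d n : ℕ} (hn : 1 ≤ n) (p : Fin n → Fin d → ℝ) {L A : ℝ}
    (hL : 0 ≤ L) :
    ∃ f : (Fin d → ℝ) → ℝ, Continuous f ∧ (∀ x, 0 ≤ f x) ∧ (∀ x, f x ≤ 1) ∧
      (∀ x i s, |f (x + s • Pi.single i 1) - f x| ≤ L * |s|) ∧
      (∀ x k, ∑ j, |x j - p k j| ≤ A → f x = 0) ∧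
      ∀ x, (∀ k, 2 * A ≤ ∑ j, |x j - p k j|) → min 1 (L * A) ≤ f x := by
  have : Nonempty (Fin n) := ⟨⟨0, hn⟩⟩
  have hne : (Finset.univ : Finset (Fin n)).Nonempty := Finset.univ_nonempty
  let D : (Fin d → ℝ) → ℝ := fun x => Finset.univ.inf' hne fun k => ∑ j, |x j - p k j|
  have hD : Continuous D := Continuous.finset_inf'_apply hne fun k _ => by fun_prop
  let f : (Fin d → ℝ) → ℝ := fun x => min 1 (L * max 0 (D x - A))
  have hDshift : ∀ x i s, D (x + s • Pi.single i 1) ≤ D x + |s| := fun x i s => by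
    obtain ⟨k, _, hk⟩ := Finset.exists_mem_eq_inf' hne fun k => ∑ j, |x j - p k j|
    calc D (x + s • Pi.single i 1) ≤ ∑ j, |(x + s • (Pi.single i 1 : Fin d → ℝ)) j - p k j| :=
          Finset.inf'_le _ (Finset.mem_univ k)
      _ ≤ ∑ j, (|x j - p k j| + |s| * (Pi.single i (1 : ℝ) : Fin d → ℝ) j) :=
          Finset.sum_le_sum fun j _ => by
            have h1 : (x + s • (Pi.single i 1 : Fin d → ℝ)) j - p k j
                = (x j - p k j) + s * (Pi.single i (1 : ℝ) : Fin d → ℝ) j := by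
              simp only [Pi.add_apply, Pi.smul_apply, smul_eq_mul]; ring
            have h2 : 0 ≤ (Pi.single i (1 : ℝ) : Fin d → ℝ) j := by
              rw [Pi.single_apply]; split_ifs <;> norm_num
            rw [h1]
            refine (abs_add_le _ _).trans ?_
            rw [abs_mul, abs_of_nonneg h2]
      _ = D x + |s| := by
          rw [Finset.sum_add_distrib, ← Finset.mul_sum, Finset.sum_pi_single']
          simp [D, hk]
  have hshift : ∀ x i s, f (x + s • Pi.single i 1) ≤ f x + L * |s| := fun x i s => by
    have h1 : max 0 (D (x + s • Pi.single i 1) - A) ≤ max 0 (D x - A) + |s| := by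
      have := hDshift x i s
      refine max_le (add_nonneg (le_max_left _ _) (abs_nonneg _)) ?_
      linarith [le_max_right 0 (D x - A)]
    have h2 := mul_le_mul_of_nonneg_left h1 hL
    have h3 : 0 ≤ L * |s| := by positivity
    simp only [f]
    rw [← min_add_add_right]
    refine min_le_min (by linarith) (by linarith)
  refine ⟨f, by fun_prop, fun x => ?_, fun x => min_le_left _ _, fun x i s => ?_, fun x k hk => ?_,
    fun x hx => ?_⟩
  · exact le_min zero_le_one (mul_nonneg hL (le_max_left _ _))
  · rw [abs_le]
    have h1 := hshift x i s
    have h2 := hshift (x + s • Pi.single i 1) i (-s)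
    rw [neg_smul, add_neg_cancel_right, abs_neg] at h2
    constructor <;> linarith
  · have h1 : D x ≤ A := (Finset.inf'_le _ (Finset.mem_univ k)).trans hk
    have h2 : max 0 (D x - A) = 0 := max_eq_left (by linarith)
    simp [f, h2]
  · have h1 : 2 * A ≤ D x := Finset.le_inf' _ _ fun k _ => hx k
    refine min_le_min_left _ (mul_le_mul_of_nonneg_left ?_ hL)
    exact le_max_of_le_right (by linarith)

theorem volume_sum_abs_le {d : ℕ} (hd : 1 ≤ d) (R : ℝ) (p : Fin d → ℝ) :
    volume {x : Fin d → ℝ | ∑ j, |x j - p j| ≤ R}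
      = ENNReal.ofReal R ^ d * ENNReal.ofReal (2 ^ d / d.factorial) := by
  have : Nonempty (Fin d) := ⟨⟨0, hd⟩⟩
  have h := volume_sum_rpow_le (Fin d) le_rfl R
  simp only [Real.rpow_one, div_one, Fintype.card_fin] at h
  rw [show (1 : ℝ) + 1 = 2 by norm_num, Real.Gamma_two, mul_one, Real.Gamma_nat_eq_factorial] at h
  rw [← h]
  exact (measurePreserving_sub_right volume p).measure_preimage
    (s := {x : Fin d → ℝ | ∑ j, |x j| ≤ R})
    (isClosed_le (by fun_prop) continuous_const).measurableSet.nullMeasurableSet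

/-- The factor `d^d` from the radius is absorbed by the `d!` of the `ℓ¹` ball, as `d^d / d! ≤ e^d`.
-/
theorem volume_sum_abs_le_le {d : ℕ} (hd : 1 ≤ d) {δ : ℝ} (hδ : 0 ≤ δ) (p : Fin d → ℝ) :
    volume {x : Fin d → ℝ | ∑ j, |x j - p j| ≤ 3 * (d * δ)}
      ≤ ENNReal.ofReal ((6 * Real.exp 1 * δ) ^ d) := by
  rw [volume_sum_abs_le hd, ← ENNReal.ofReal_pow (by positivity), ← ENNReal.ofReal_mul
    (by positivity)]
  refine ENNReal.ofReal_le_ofReal ?_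
  have h := Real.pow_div_factorial_le_exp d (Nat.cast_nonneg d) d
  have he : Real.exp d = Real.exp 1 ^ d := by rw [← Real.exp_nat_mul, mul_one]
  rw [he] at h
  calc (3 * (d * δ)) ^ d * (2 ^ d / d.factorial)
      = (6 * δ) ^ d * ((d : ℝ) ^ d / d.factorial) := by
        rw [show (6 : ℝ) * δ = 3 * δ * 2 by ring]
        simp only [mul_pow]; ring
    _ ≤ (6 * δ) ^ d * Real.exp 1 ^ d := mul_le_mul_of_nonneg_left h (by positivity)
    _ = _ := by rw [← mul_pow]; ring

theorem exists_fooling_function (r : ℕ) (hr : 1 ≤ r) :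
    ∃ c : ℝ, 0 < c ∧ ∀ d n : ℕ, 1 ≤ d → 1 ≤ n → ∀ p : Fin n → Fin d → ℝ,
      ∃ f ∈ smoothClass r d, (∀ k, f (p k) = 0) ∧
        min (1 / 2) (c * d * (n : ℝ) ^ (-((r : ℝ) / d))) ≤ cubeIntegral d f := by
  obtain ⟨C, hC1, hker⟩ := exists_smooth_kernel r
  have hC0 : 0 < C := by linarith
  let E : ℝ := 12 * Real.exp 1
  have hE1 : 1 ≤ E := by
    have := Real.add_one_le_exp 1
    simp only [E]; linarith
  have hE0 : 0 < E := by linarith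
  -- With `δ = n^{-1/d} / E` and `L = (δ/C)^{r-1}`, this is the constant in `1/2 * L * d * δ`.
  refine ⟨1 / 2 * (E⁻¹ ^ r * C⁻¹ ^ (r - 1)), by positivity, fun d n hd hn p => ?_⟩
  have hn1 : (1 : ℝ) ≤ n := by exact_mod_cast hn
  have hd1 : (1 : ℝ) ≤ d := by exact_mod_cast hd
  have hd0 : (d : ℝ) ≠ 0 := by positivity
  let q : ℝ := (n : ℝ) ^ (-(1 / (d : ℝ)))
  have hq0 : 0 < q := Real.rpow_pos_of_pos (by linarith) _
  have hq1 : q ≤ 1 := Real.rpow_le_one_of_one_le_of_nonpos hn1 (by simp)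
  have hqd : q ^ d = (n : ℝ)⁻¹ := by
    rw [← Real.rpow_natCast, ← Real.rpow_mul (by linarith), neg_mul, one_div_mul_cancel hd0,
      Real.rpow_neg_one]
  have hqr : q ^ r = (n : ℝ) ^ (-((r : ℝ) / d)) := by
    rw [← Real.rpow_natCast, ← Real.rpow_mul (by linarith)]
    congr 1; ring
  let δ : ℝ := E⁻¹ * q
  have hδ0 : 0 < δ := by positivity
  have hδ1 : δ ≤ 1 := mul_le_one₀ (inv_le_one_of_one_le₀ hE1) hq0.le hq1
  obtain ⟨ψ, hψ, hψc, hψ0, hψ1, hψδ, hψB⟩ := hker δ hδ0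
  have hB1 : 1 ≤ C / δ := (one_le_div hδ0).2 (hδ1.trans hC1)
  let L : ℝ := (δ / C) ^ (r - 1)
  have hL0 : 0 < L := by positivity
  obtain ⟨f, hfc, hf0, hf1, hfL, hfp, hfar⟩ :=
    exists_truncated_distance hn p (A := d * δ) hL0.le
  have hfabs : ∀ x, |f x| ≤ 1 := fun x => by rw [abs_of_nonneg (hf0 x)]; exact hf1 x
  have hLB : L * (C / δ) ^ (r - 1) ≤ 1 := by
    rw [← mul_pow, div_mul_div_cancel₀ hC0.ne', div_self hδ0.ne', one_pow]
  let F := mollify f ψ 0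
  have hF0 : ∀ x, 0 ≤ F x := fun x => by
    simp only [F, mollify_apply]
    exact integral_nonneg fun t => mul_nonneg (hf0 _) (prodKernel_zero_nonneg hψ0 t)
  have hFc : Continuous F := (contDiff_mollify hfc hψ hψc 0).continuous
  refine ⟨F, mollify_mem_smoothClass hfc hfabs hL0.le hfL hψ hψc hψ0 hψ1 hB1 hψB hLB,
    fun k => ?_, ?_⟩
  · simp only [F, mollify_apply]
    refine integral_eq_zero_of_ae (Filter.Eventually.of_forall fun t => ?_)
    by_cases ht : prodKernel ψ 0 t = 0
    · simp [ht]
    · have h1 := sum_abs_le_of_prodKernel_zero_ne_zero hψδ ht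
      have h2 := hfp (p k - t) k (by simpa using h1)
      simp [h2]
  let m : ℝ := min 1 (L * (d * δ))
  have hm0 : 0 ≤ m := le_min zero_le_one (by positivity)
  -- The radius is `2dδ`, beyond which `f` is at least `m`, plus the `ℓ¹` reach `dδ` of the kernel.
  let U : Set (Fin d → ℝ) := ⋃ k, {x | ∑ j, |x j - p k j| ≤ 3 * (d * δ)}
  have hUmeas : MeasurableSet U := MeasurableSet.iUnion fun k =>
    (isClosed_le (by fun_prop) continuous_const).measurableSet
  have hUle : volume U ≤ ENNReal.ofReal (1 / 2) := by
    calc volume U ≤ ∑ k, volume {x : Fin d → ℝ | ∑ j, |x j - p k j| ≤ 3 * (d * δ)} :=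
          measure_iUnion_fintype_le _ _
      _ ≤ ∑ _k : Fin n, ENNReal.ofReal ((6 * Real.exp 1 * δ) ^ d) :=
          Finset.sum_le_sum fun k _ => volume_sum_abs_le_le hd hδ0.le (p k)
      _ = ENNReal.ofReal (n * (6 * Real.exp 1 * δ) ^ d) := by
          rw [Finset.sum_const, Finset.card_univ, Fintype.card_fin, nsmul_eq_mul,
            ENNReal.ofReal_mul (by positivity), ENNReal.ofReal_natCast]
      _ ≤ ENNReal.ofReal (1 / 2) := by
          refine ENNReal.ofReal_le_ofReal ?_
          -- `E = 12e` is chosen for this: the `n` balls have total volume at most `2^{-d} ≤ 1/2`.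
          have h2 : 6 * Real.exp 1 * δ = 1 / 2 * q := by
            simp only [δ, E]
            field_simp
            norm_num
          rw [h2, mul_pow, hqd, mul_left_comm, mul_inv_cancel₀ (by positivity), mul_one]
          exact pow_le_of_le_one (by norm_num) (by norm_num) (by omega)
  have hUvol : volume.real U ≤ 1 / 2 := ENNReal.toReal_le_of_le_ofReal (by norm_num) hUle
  have hFar : ∀ x ∉ U, m ≤ F x := fun x hx => by
    simp only [U, mem_iUnion, mem_ofPred_eq, not_exists, not_le] at hx
    have hle : ∀ t, m * prodKernel ψ 0 t ≤ f (x - t) * prodKernel ψ 0 t := fun t => by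
      by_cases ht : prodKernel ψ 0 t = 0
      · simp [ht]
      · refine mul_le_mul_of_nonneg_right (hfar _ fun k => ?_) (prodKernel_zero_nonneg hψ0 t)
        have h1 := sum_abs_le_of_prodKernel_zero_ne_zero hψδ ht
        have h2 : ∑ j, |x j - p k j| ≤ ∑ j, (|(x - t) j - p k j| + |t j|) :=
          Finset.sum_le_sum fun j _ => by
            have : x j - p k j = ((x - t) j - p k j) + t j := by
              rw [Pi.sub_apply]; ring
            rw [this]
            exact abs_add_le _ _
        rw [Finset.sum_add_distrib] at h2
        linarith [hx k]
    have h3 := integral_mono ((integrable_prodKernel hψ hψc 0).const_mul m)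
      (integrable_mollify_integrand hfc hfabs hψ hψc 0 x) hle
    rwa [integral_const_mul, integral_prodKernel_zero hψ1, mul_one, ← mollify_apply] at h3
  have hcubemeas : MeasurableSet (unitCube d) := measurableSet_Icc
  have hvol : 1 / 2 ≤ volume.real (unitCube d \ U) := by
    have h1 : volume.real (unitCube d) = 1 := by simp [Measure.real, volume_unitCube]
    have h3 := le_measureReal_sdiff (μ := volume) (s₁ := unitCube d) (s₂ := U)
      (hUle.trans_lt ENNReal.ofReal_lt_top).ne
    linarith
  have hint : 1 / 2 * m ≤ cubeIntegral d F := by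
    have hFi : IntegrableOn F (unitCube d) :=
      hFc.continuousOn.integrableOn_compact (isCompact_unitCube d)
    have hfin : volume (unitCube d \ U) ≠ ⊤ :=
      ((measure_mono sdiff_subset).trans_lt (by simp [volume_unitCube])).ne
    calc 1 / 2 * m ≤ volume.real (unitCube d \ U) * m := mul_le_mul_of_nonneg_right hvol hm0
      _ = ∫ _ in unitCube d \ U, m := by rw [setIntegral_const, smul_eq_mul]
      _ ≤ ∫ x in unitCube d \ U, F x :=
          setIntegral_mono_on (integrableOn_const hfin) (hFi.mono_set sdiff_subset)
            (hcubemeas.diff hUmeas) fun x hx => hFar x hx.2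
      _ ≤ cubeIntegral d F := setIntegral_mono_set hFi
          (Filter.Eventually.of_forall hF0) sdiff_subset.eventuallyLE
  refine le_trans (le_of_eq ?_) hint
  rw [← hqr, mul_min_of_nonneg _ _ (by norm_num : (0 : ℝ) ≤ 1 / 2), mul_one]
  congr 1
  have h1 : δ ^ r = δ ^ (r - 1) * δ := by rw [← pow_succ, Nat.sub_add_cancel hr]
  have h2 : δ ^ r = E⁻¹ ^ r * q ^ r := mul_pow _ _ _
  calc _ = 1 / 2 * (C⁻¹ ^ (r - 1) * d * (E⁻¹ ^ r * q ^ r)) := by ring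
    _ = _ := by rw [← h2, h1]; simp only [L, div_eq_mul_inv, mul_pow]; ring

/-! ### Adaptive algorithms and the final bounds. -/

theorem neg_mem_smoothClass {r d : ℕ} {f : (Fin d → ℝ) → ℝ} (hf : f ∈ smoothClass r d) :
    -f ∈ smoothClass r d := by
  refine ⟨hf.1.neg, fun k hk w x hx => ?_⟩
  rw [mixedPartial, iteratedFDerivWithin_neg_apply (uniqueDiffOn_unitCube d) hx]
  simpa [mixedPartial] using hf.2 k hk w x hx

theorem SamplingAlgorithm.info_eq_info_zero {d n : ℕ} (A : SamplingAlgorithm d n)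
    {f : (Fin d → ℝ) → ℝ} (hf : ∀ k : Fin n, f (A.point k (A.info 0 k)) = 0) :
    ∀ k ≤ n, A.info f k = A.info 0 k := by
  intro k
  induction k with
  | zero => intro _; rfl
  | succ k ih =>
    intro hk
    simp only [SamplingAlgorithm.info, ih (by omega), hf ⟨k, hk⟩, Pi.zero_apply]

/-- The algorithm returns `A.run 0` for both `f` and `-f`; depending on the sign of this number, it
misses one of the two integrals by at least `cubeIntegral d f`. -/
theorem ofReal_cubeIntegral_le_worstCaseError {r d n : ℕ} (A : SamplingAlgorithm d n)
    {f : (Fin d → ℝ) → ℝ} (hf : f ∈ smoothClass r d)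
    (hzero : ∀ k : Fin n, f (A.point k (A.info 0 k)) = 0) :
    ENNReal.ofReal (cubeIntegral d f) ≤ A.worstCaseError r := by
  have hrun : A.run f = A.run 0 := congrArg A.output (A.info_eq_info_zero hzero n le_rfl)
  have hrun' : A.run (-f) = A.run 0 :=
    congrArg A.output (A.info_eq_info_zero (fun k => by simp [hzero k]) n le_rfl)
  have hneg : cubeIntegral d (-f) = -cubeIntegral d f := integral_neg _
  have h1 : ENNReal.ofReal |cubeIntegral d f - A.run f| ≤ A.worstCaseError r :=
    le_iSup₂ (f := fun g _ => ENNReal.ofReal |cubeIntegral d g - A.run g|) f hf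
  have h2 : ENNReal.ofReal |cubeIntegral d (-f) - A.run (-f)| ≤ A.worstCaseError r :=
    le_iSup₂ (f := fun g _ => ENNReal.ofReal |cubeIntegral d g - A.run g|) (-f)
      (neg_mem_smoothClass hf)
  rw [hrun] at h1
  rw [hrun', hneg] at h2
  rcases le_total (A.run 0) 0 with h | h
  · exact (ENNReal.ofReal_le_ofReal (le_trans (by linarith) (le_abs_self _))).trans h1
  · exact (ENNReal.ofReal_le_ofReal (le_trans (by linarith) (neg_le_abs _))).trans h2

/-- In the last bound the power is taken in `[0,∞]`, so that `0 ^ (-r) = ∞` for `n = 1`. -/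
theorem theorem2 (r : ℕ) (hr : 1 ≤ r) :
    ∃ c₁ c₂ : ℝ, 0 < c₁ ∧ 0 < c₂ ∧ ∀ d n : ℕ, 1 ≤ d → 1 ≤ n →
      ENNReal.ofReal (min (1 / 2) (c₁ * (d : ℝ) * (n : ℝ) ^ (-((r : ℝ) / (d : ℝ)))))
          ≤ minimalError r d n ∧
      ((∃ m : ℕ, n = m ^ d) →
        minimalError r d n
          ≤ ENNReal.ofReal (min 1 (c₂ * (d : ℝ) * (n : ℝ) ^ (-((r : ℝ) / (d : ℝ)))))) ∧
      minimalError r d n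
        ≤ min 1 (ENNReal.ofReal (c₂ * (d : ℝ)) *
            ENNReal.ofReal ((n : ℝ) ^ (1 / (d : ℝ)) - 1) ^ (-(r : ℝ))) := by
  obtain ⟨c₁, hc₁, hlow⟩ := exists_fooling_function r hr
  obtain ⟨c₂, hc₂, hup⟩ := exists_minimalError_le r hr
  refine ⟨c₁, c₂, hc₁, hc₂, fun d n hd hn => ⟨?_, ?_, ?_⟩⟩
  · refine le_iInf fun A => ?_
    obtain ⟨f, hf, hzero, hint⟩ := hlow d n hd hn fun k => A.point k (A.info 0 k)
    exact (ENNReal.ofReal_le_ofReal hint).trans (ofReal_cubeIntegral_le_worstCaseError A hf hzero)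
  · rintro ⟨m, rfl⟩
    have hd0 : (d : ℝ) ≠ 0 := by positivity
    have hm : 1 ≤ m := by
      rcases Nat.eq_zero_or_pos m with rfl | h
      · rw [zero_pow (by omega)] at hn; omega
      · exact h
    have h1 : ((m ^ d : ℕ) : ℝ) ^ (-((r : ℝ) / d)) = (1 / (m : ℝ)) ^ r := by
      rw [Nat.cast_pow, ← Real.rpow_natCast, ← Real.rpow_mul (Nat.cast_nonneg m),
        mul_neg, mul_div_cancel₀ _ hd0, Real.rpow_neg (Nat.cast_nonneg m), Real.rpow_natCast,
        one_div, inv_pow]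
    rw [h1]
    exact hup d (m ^ d) m hd hm le_rfl
  · have hd0 : (d : ℝ) ≠ 0 := by positivity
    have hn1 : (1 : ℝ) ≤ n := by exact_mod_cast hn
    let y : ℝ := (n : ℝ) ^ (1 / (d : ℝ))
    have hy1 : 1 ≤ y := Real.one_le_rpow hn1 (by positivity)
    have hyd : y ^ d = n := by
      rw [← Real.rpow_natCast, ← Real.rpow_mul (by linarith), one_div_mul_cancel hd0,
        Real.rpow_one]
    -- For general `n` the grid size is `m = ⌊n^{1/d}⌋`, which satisfies `m^d ≤ n` and `m ≥ n^{1/d}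
    -- - 1`.
    have hm1 : 1 ≤ ⌊y⌋₊ := Nat.one_le_floor_iff _ |>.2 hy1
    have hmy : (⌊y⌋₊ : ℝ) ≤ y := Nat.floor_le (by linarith)
    have hmd : ⌊y⌋₊ ^ d ≤ n := by
      have : (⌊y⌋₊ : ℝ) ^ d ≤ n := hyd ▸ pow_le_pow_left₀ (Nat.cast_nonneg _) hmy d
      exact_mod_cast this
    have h := hup d n ⌊y⌋₊ hd hm1 hmd
    rw [ENNReal.ofReal_min, ENNReal.ofReal_one] at h
    refine h.trans (min_le_min_left _ ?_)
    rw [ENNReal.ofReal_mul (by positivity)]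
    refine mul_le_mul_right ?_ _
    have hm0 : (0 : ℝ) < ⌊y⌋₊ := by exact_mod_cast hm1
    have hle : ENNReal.ofReal (y - 1) ≤ ENNReal.ofReal ⌊y⌋₊ :=
      ENNReal.ofReal_le_ofReal (by linarith [Nat.lt_floor_add_one y])
    rw [ENNReal.rpow_neg, ENNReal.rpow_natCast, one_div, inv_pow,
      ENNReal.ofReal_inv_of_pos (by positivity), ENNReal.ofReal_pow (by positivity)]
    exact ENNReal.inv_le_inv.2 (pow_le_pow_left' hle r)
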